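/- Let $K$ be a field, $\Gamma$ a linearly ordered abelian group, and $\nu: K[x]\to\Gamma\cup\{\infty\}$ a valuation with trivial support, i.e. $\nu(fg)=\nu(f)+\nu(g)$, $\nu(f+g)\ge\min\{\nu(f),\nu(g)\}$, $\nu(1)=0$, and $\nu(f)=\infty$ if and only if $f=0$. Extend $\nu$ to $K(x)$ by $\nu(f/g)=\nu(f)-\nu(g)$, let $\nu K\subseteq \nu(K(x))$ be the value groups and $K\nu\subseteq K(x)\nu$ the residue fields of $\nu|_K$ and of $\nu$ on $K(x)$. The valuation $\nu$ is called valuation-algebraic if $\nu(K(x))/\nu K$ is a torsion group and $K(x)\nu\mid K\nu$ is an algebraic extension, and valuation-transcendental otherwise. (So $\nu$ is valuation-transcendental precisely when it is value-transcendental, i.e. there is a nonzero $f\in K(x)$ with $n\,\nu(f)\notin\nu K$ for all $n\ge 1$, or residue-transcendental, i.e. there is $f\in K(x)$ with $\nu(f)\ge 0$ whose residue is transcendental over $K\nu$.) For a nonconstant polynomial $q\in K[x]$, every $p\in K[x]$ has a unique $q$-expansion $p=p_0+p_1q+\dots+p_nq^n$ with each $p_i\in K[x]$ zero or of degree less than $\deg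 q$; put $\nu_q(p)=\min_{0\le i\le n}\nu(p_iq^i)$. **Theorem.** The valuation $\nu$ is valuation-transcendental if and only if there exists a nonconstant polynomial $q\in K[x]$ such that $\nu=\nu_q$. -/

import Mathlib

open Polynomial

namespace ValTrunc

universe u v

section Expansion

variable {K : Type u} [Field K]

/-- The `i`-th coefficient `p_i` of the `q`-expansion `p = p_0 + p_1 q + ... + p_n q ^ n`, obtained
by repeated division with remainder by `q` (meaningful for nonconstant `q`, see
`sum_expansionCoeff`, `degree_expansionCoeff_lt` and `expansionCoeff_unique` below). -/
noncomputable def expansionCoeff (q : K[X]) : K[X] → ℕ → K[X]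
  | p, 0 => p % q
  | p, i + 1 => expansionCoeff q (p / q) i

theorem expansionCoeff_zero_left (q : K[X]) (i : ℕ) : expansionCoeff q 0 i = 0 := by
  induction i with
  | zero => simp [expansionCoeff]
  | succ i ih => simp [expansionCoeff, ih]

/-- Each coefficient of the `q`-expansion is zero or of degree smaller than `deg q`. -/
theorem degree_expansionCoeff_lt {q : K[X]} (hq : 0 < q.natDegree) (p : K[X]) (i : ℕ) :
    (expansionCoeff q p i).degree < q.degree := by
  have hq0 : q ≠ 0 := by rintro rfl; simp at hq
  induction i generalizing p with
  | zero => exact EuclideanDomain.mod_lt p hq0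
  | succ i ih => exact ih (p / q)

/-- The `q`-expansion of `p` sums up to `p`; it stops after at most `deg p + 1` terms. -/
theorem sum_expansionCoeff {q : K[X]} (hq : 0 < q.natDegree) (p : K[X]) (n : ℕ)
    (hn : p.natDegree < n) :
    ∑ i ∈ Finset.range n, expansionCoeff q p i * q ^ i = p := by
  induction n generalizing p with
  | zero => omega
  | succ n ih =>
    rw [Finset.sum_range_succ']
    have h1 : ∑ i ∈ Finset.range n, expansionCoeff q p (i + 1) * q ^ (i + 1)
        = (p / q) * q := by
      by_cases h0 : p / q = 0
      · simp [expansionCoeff, h0, expansionCoeff_zero_left]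
      · have hd : (p / q).natDegree < n := by
          have hp : p ≠ 0 := by rintro rfl; simp at h0
          have := Polynomial.natDegree_lt_natDegree h0
            (Polynomial.degree_div_lt hp (Polynomial.natDegree_pos_iff_degree_pos.1 hq))
          omega
        conv_rhs => rw [← ih (p / q) hd, Finset.sum_mul]
        refine Finset.sum_congr rfl fun i _ => ?_
        rw [expansionCoeff]; ring
    rw [h1]
    simp only [expansionCoeff, pow_zero, mul_one]
    rw [mul_comm]; exact EuclideanDomain.div_add_mod p q

/-- Uniqueness of the `q`-expansion. -/
theorem expansionCoeff_unique {q : K[X]} (hq : 0 < q.natDegree) (n : ℕ) (c : ℕ → K[X])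
    (hc : ∀ i, (c i).degree < q.degree) (p : K[X])
    (hp : ∑ i ∈ Finset.range n, c i * q ^ i = p) (i : ℕ) (hi : i < n) :
    expansionCoeff q p i = c i := by
  have hq0 : q ≠ 0 := by rintro rfl; simp at hq
  induction n generalizing c p i with
  | zero => omega
  | succ n ih =>
    rw [Finset.sum_range_succ'] at hp
    have h1 : p = q * (∑ j ∈ Finset.range n, c (j + 1) * q ^ j) + c 0 := by
      rw [← hp, Finset.mul_sum]
      simp only [pow_zero, mul_one, add_left_inj]
      exact Finset.sum_congr rfl fun j _ => by ring
    have h3 : c 0 % q = c 0 := (Polynomial.mod_eq_self_iff hq0).2 (hc 0)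
    have h4 : p % q = c 0 := by
      rw [h1, Polynomial.add_mod, h3]
      simp
    have h5 : p / q = ∑ j ∈ Finset.range n, c (j + 1) * q ^ j := by
      have h := EuclideanDomain.div_add_mod p q
      rw [h4] at h
      nth_rewrite 2 [h1] at h
      exact mul_left_cancel₀ hq0 (add_right_cancel h)
    cases i with
    | zero =>
      rw [expansionCoeff, h4]
    | succ i =>
      rw [expansionCoeff]
      exact ih (fun j => c (j + 1)) (fun j => hc _) (p / q) h5.symm i (by omega)

end Expansion

section Valuations

variable {K : Type u} [Field K] {Γ : Type v} [AddCommGroup Γ] [LinearOrder Γ]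
  [IsOrderedAddMonoid Γ]

/-- The `q`-truncation `ν_q(p) = min_i ν(p_i q ^ i)` of `ν`, where `p = ∑ p_i q ^ i` is the
`q`-expansion of `p`. All coefficients with index larger than `deg p` vanish when `q` is not
constant, and vanishing coefficients contribute the value `∞`. -/
noncomputable def truncation (ν : AddValuation K[X] (WithTop Γ)) (q p : K[X]) : WithTop Γ :=
  (Finset.range (p.natDegree + 1)).inf fun i => ν (expansionCoeff q p i * q ^ i)

/-- The truncation may be computed from any expression of `p` as a `q`-expansion. -/
theorem truncation_eq (ν : AddValuation K[X] (WithTop Γ)) {q : K[X]} (hq : 0 < q.natDegree)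
    (n : ℕ) (c : ℕ → K[X]) (hc : ∀ i, (c i).degree < q.degree) (p : K[X])
    (hp : ∑ i ∈ Finset.range n, c i * q ^ i = p) :
    truncation ν q p = (Finset.range n).inf fun i => ν (c i * q ^ i) := by
  have key : ∀ m, p.natDegree < m → n ≤ m →
      (Finset.range m).inf (fun i => ν (expansionCoeff q p i * q ^ i)) =
        (Finset.range n).inf fun i => ν (c i * q ^ i) := by
    intro m hm hnm
    have hq0 : ⊥ < q.degree := bot_lt_iff_ne_bot.2 fun h => by
      rw [degree_eq_bot] at h; simp [h] at hq
    set d : ℕ → K[X] := fun i => if i < n then c i else 0 with hd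
    have hdd : ∀ i, (d i).degree < q.degree := by
      intro i
      simp only [hd]
      split_ifs
      · exact hc i
      · simpa using hq0
    have hsub : Finset.range n ⊆ Finset.range m := Finset.range_subset_range.2 hnm
    have hds : ∑ i ∈ Finset.range m, d i * q ^ i = p := by
      rw [← hp, ← Finset.sum_subset hsub]
      · refine Finset.sum_congr rfl fun i hi => ?_
        simp [hd, Finset.mem_range.1 hi]
      · intro i _ hi
        have : ¬ i < n := fun h => hi (Finset.mem_range.2 h)
        simp [hd, this]
    have he := expansionCoeff_unique hq m d hdd p hds
    apply le_antisymm
    · refine Finset.le_inf fun i hi => ?_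
      refine (Finset.inf_le (hsub hi)).trans ?_
      have hi' := Finset.mem_range.1 hi
      rw [he i (by omega)]
      simp [hd, hi']
    · refine Finset.le_inf fun i hi => ?_
      rw [he i (Finset.mem_range.1 hi)]
      by_cases h : i < n
      · simpa [hd, h] using Finset.inf_le (f := fun i => ν (c i * q ^ i)) (Finset.mem_range.2 h)
      · simp [hd, h]
  by_cases hle : n ≤ p.natDegree + 1
  · exact key _ (by omega) hle
  · rw [← key n (by omega) le_rfl, truncation]
    have h0 := key n (by omega) le_rfl
    have hs := sum_expansionCoeff hq p (p.natDegree + 1) (by omega)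
    have hz : ∀ i, i < n → ¬ i < p.natDegree + 1 → expansionCoeff q p i = 0 := by
      intro i hi hi2
      have hq0 : ⊥ < q.degree := bot_lt_iff_ne_bot.2 fun h => by
        rw [degree_eq_bot] at h; simp [h] at hq
      have hu := expansionCoeff_unique hq n
        (fun j => if j < p.natDegree + 1 then expansionCoeff q p j else 0) (fun j => by
          split_ifs
          · exact degree_expansionCoeff_lt hq p j
          · simpa using hq0) p (by
          conv_rhs => rw [← hs]
          rw [← Finset.sum_subset (Finset.range_subset_range.2 (by omega :
            p.natDegree + 1 ≤ n))]
          · refine Finset.sum_congr rfl fun i hi => ?_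
            rw [if_pos (Finset.mem_range.1 hi)]
          · intro i _ hi
            rw [if_neg (fun h => hi (Finset.mem_range.2 h)), zero_mul]) i hi
      rw [hu, if_neg hi2]
    apply le_antisymm
    · refine Finset.le_inf fun i hi => ?_
      by_cases h : i < p.natDegree + 1
      · exact Finset.inf_le (f := fun i => ν (expansionCoeff q p i * q ^ i)) (Finset.mem_range.2 h)
      · rw [hz i (Finset.mem_range.1 hi) h]; simp
    · exact Finset.inf_mono (Finset.range_subset_range.2 (by omega))

/-- The restriction of `ν` to the constants `K`. -/
noncomputable def baseVal (ν : AddValuation K[X] (WithTop Γ)) : AddValuation K (WithTop Γ) :=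
  ν.comap C

theorem nonZeroDivisors_le_primeCompl (ν : AddValuation K[X] (WithTop Γ)) (hν : ν.supp = ⊥) :
    nonZeroDivisors K[X] ≤ (AddValuation.toValuation ν).supp.primeCompl := by
  intro p hp hmem
  have h : p ∈ ν.supp := hmem
  rw [hν, Ideal.mem_bot] at h
  exact nonZeroDivisors.ne_zero hp h

/-- The extension of a valuation `ν` on `K[x]` with zero support to `K(x)`, that is
`ν(f / g) = ν(f) - ν(g)`. -/
noncomputable def ratVal (ν : AddValuation K[X] (WithTop Γ)) (hν : ν.supp = ⊥) :
    AddValuation (RatFunc K) (WithTop Γ) :=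
  AddValuation.ofValuation ((AddValuation.toValuation ν).extendToLocalization
    (nonZeroDivisors_le_primeCompl ν hν) (RatFunc K))

theorem ratVal_algebraMap (ν : AddValuation K[X] (WithTop Γ)) (hν : ν.supp = ⊥) (p : K[X]) :
    ratVal ν hν (algebraMap K[X] (RatFunc K) p) = ν p :=
  Valuation.extendToLocalization_apply_map_apply (AddValuation.toValuation ν)
    (nonZeroDivisors_le_primeCompl ν hν) (RatFunc K) p

theorem ratVal_div (ν : AddValuation K[X] (WithTop Γ)) (hν : ν.supp = ⊥) (f g : K[X]) :
    ratVal ν hν (algebraMap K[X] (RatFunc K) f / algebraMap K[X] (RatFunc K) g) = ν f - ν g := by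
  rw [AddValuation.map_div, ratVal_algebraMap, ratVal_algebraMap]

/-- The value group of a valuation: the subgroup of `Γ` generated by the finite values. -/
def valueGroup {R : Type u} [CommRing R] (w : AddValuation R (WithTop Γ)) : AddSubgroup Γ :=
  AddSubgroup.closure {γ : Γ | ∃ a : R, w a = (γ : WithTop Γ)}

/-- The valuation ring `{a | w a ≥ 0}` of a valuation on a field. -/
abbrev valRing {F : Type u} [Field F] (w : AddValuation F (WithTop Γ)) : ValuationSubring F :=
  (AddValuation.toValuation w).valuationSubring

theorem mem_valRing {F : Type u} [Field F] (w : AddValuation F (WithTop Γ)) (a : F) :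
    a ∈ valRing w ↔ 0 ≤ w a := Iff.rfl

/-- The residue field of a valuation on a field. -/
abbrev ResField {F : Type u} [Field F] (w : AddValuation F (WithTop Γ)) : Type u :=
  IsLocalRing.ResidueField (valRing w)

theorem ratVal_algebraMap_base (ν : AddValuation K[X] (WithTop Γ)) (hν : ν.supp = ⊥) (a : K) :
    ratVal ν hν (algebraMap K (RatFunc K) a) = baseVal ν a := by
  rw [IsScalarTower.algebraMap_apply K K[X] (RatFunc K), ratVal_algebraMap]
  rfl

/-- `ratVal ν` extends `baseVal ν`; this provides the inclusion `Kν → K(x)ν` of residue fields,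
sending the residue of `a` to the residue of the constant `a`. -/
instance hasExtension_ratVal (ν : AddValuation K[X] (WithTop Γ)) (hν : ν.supp = ⊥) :
    Valuation.HasExtension (AddValuation.toValuation (baseVal ν))
      (AddValuation.toValuation (ratVal ν hν)) where
  val_isEquiv_comap := by
    have h : AddValuation.toValuation (baseVal ν)
        = (AddValuation.toValuation (ratVal ν hν)).comap (algebraMap K (RatFunc K)) := by
      ext a
      exact (congrArg (fun t => Multiplicative.ofAdd (OrderDual.toDual t))
        (ratVal_algebraMap_base ν hν a)).symm
    rw [h]
    exact Valuation.IsEquiv.refl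

/-- The inclusion `Kν → K(x)ν` sends the residue of `a` to the residue of the constant `a`. -/
theorem algebraMap_residue (ν : AddValuation K[X] (WithTop Γ)) (hν : ν.supp = ⊥)
    (a : valRing (baseVal ν)) (ha : algebraMap K (RatFunc K) a ∈ valRing (ratVal ν hν)) :
    algebraMap (ResField (baseVal ν)) (ResField (ratVal ν hν))
        (IsLocalRing.residue (valRing (baseVal ν)) a) =
      IsLocalRing.residue (valRing (ratVal ν hν)) ⟨algebraMap K (RatFunc K) a, ha⟩ :=
  rfl

/-- `ν` is valuation-algebraic if `ν(K(x)) / νK` is a torsion group and `K(x)ν | Kν` is an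
algebraic extension. -/
def IsValuationAlgebraic (ν : AddValuation K[X] (WithTop Γ)) (hν : ν.supp = ⊥) : Prop :=
  IsAddTorsion (valueGroup (ratVal ν hν) ⧸
      (valueGroup (baseVal ν)).addSubgroupOf (valueGroup (ratVal ν hν))) ∧
    Algebra.IsAlgebraic (ResField (baseVal ν)) (ResField (ratVal ν hν))

/-- `ν` is valuation-transcendental if it is not valuation-algebraic. -/
def IsValuationTranscendental (ν : AddValuation K[X] (WithTop Γ)) (hν : ν.supp = ⊥) : Prop :=
  ¬ IsValuationAlgebraic ν hν

/-- `ν` is value-transcendental if some `f ∈ K(x)` has a value in `Γ` no positive multiple of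
which lies in `νK`. -/
def IsValueTranscendental (ν : AddValuation K[X] (WithTop Γ)) (hν : ν.supp = ⊥) : Prop :=
  ∃ (f : RatFunc K) (γ : Γ), ratVal ν hν f = (γ : WithTop Γ) ∧
    ∀ n : ℕ, 0 < n → n • γ ∉ valueGroup (baseVal ν)

/-- `ν` is residue-transcendental if some `f` in the valuation ring of `K(x)` has a residue that
is transcendental over `Kν`. -/
def IsResidueTranscendental (ν : AddValuation K[X] (WithTop Γ)) (hν : ν.supp = ⊥) : Prop :=
  ∃ f : valRing (ratVal ν hν),
    Transcendental (ResField (baseVal ν)) (IsLocalRing.residue (valRing (ratVal ν hν)) f)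

/-- Over a field the value group is just the set of finite values. -/
theorem mem_valueGroup_iff {F : Type u} [Field F] (w : AddValuation F (WithTop Γ)) (γ : Γ) :
    γ ∈ valueGroup w ↔ ∃ a : F, w a = (γ : WithTop Γ) := by
  refine ⟨fun h => ?_, fun h => AddSubgroup.subset_closure h⟩
  induction h using AddSubgroup.closure_induction with
  | mem x hx => exact hx
  | zero => exact ⟨1, w.map_one⟩
  | add x y _ _ hx hy =>
    obtain ⟨a, ha⟩ := hx
    obtain ⟨b, hb⟩ := hy
    exact ⟨a * b, by rw [w.map_mul, ha, hb, WithTop.coe_add]⟩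
  | neg x _ hx =>
    obtain ⟨a, ha⟩ := hx
    exact ⟨a⁻¹, by rw [w.map_inv, ha]; rfl⟩

/-- A valuation is valuation-transcendental if and only if it is value-transcendental or
residue-transcendental. -/
theorem isValuationTranscendental_iff (ν : AddValuation K[X] (WithTop Γ)) (hν : ν.supp = ⊥) :
    IsValuationTranscendental ν hν ↔
      IsValueTranscendental ν hν ∨ IsResidueTranscendental ν hν := by
  have h1 : IsValueTranscendental ν hν ↔ ¬ IsAddTorsion (valueGroup (ratVal ν hν) ⧸
      (valueGroup (baseVal ν)).addSubgroupOf (valueGroup (ratVal ν hν))) := by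
    rw [not_isAddTorsion_iff]
    constructor
    · rintro ⟨f, γ, hf, hγ⟩
      refine ⟨QuotientAddGroup.mk ⟨γ, (mem_valueGroup_iff _ _).2 ⟨f, hf⟩⟩, fun hfin => ?_⟩
      obtain ⟨n, hn, h⟩ := isOfFinAddOrder_iff_nsmul_eq_zero.1 hfin
      rw [← QuotientAddGroup.mk_nsmul, QuotientAddGroup.eq_zero_iff] at h
      exact hγ n hn h
    · rintro ⟨x, hx⟩
      induction x using QuotientAddGroup.induction_on with
      | H z =>
        obtain ⟨γ, hz⟩ := z
        obtain ⟨f, hf⟩ := (mem_valueGroup_iff _ _).1 hz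
        refine ⟨f, γ, hf, fun n hn hmem => hx (isOfFinAddOrder_iff_nsmul_eq_zero.2 ⟨n, hn, ?_⟩)⟩
        rw [← QuotientAddGroup.mk_nsmul, QuotientAddGroup.eq_zero_iff]
        exact hmem
  have h2 : IsResidueTranscendental ν hν ↔
      ¬ Algebra.IsAlgebraic (ResField (baseVal ν)) (ResField (ratVal ν hν)) := by
    rw [Algebra.isAlgebraic_def]
    push Not
    constructor
    · rintro ⟨f, hf⟩
      exact ⟨_, hf⟩
    · rintro ⟨y, hy⟩
      obtain ⟨f, rfl⟩ := IsLocalRing.residue_surjective y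
      exact ⟨f, hy⟩
  rw [h1, h2, IsValuationTranscendental, IsValuationAlgebraic, not_and_or]

end Valuations

end ValTrunc

/-! If `ν` is transcendental, some valuation ring `V` of K(x) inside that of `ν` carries an element
`f` whose `V`-value is non-torsion modulo K. For value transcendence `V` is the valuation ring of
`ν` itself. For residue transcendence, with `t` a residue transcendental over Kν, compose that ring
with a valuation ring of K(x)ν that contains Kν but not `t⁻¹`: any lift of `t` becomes non-torsion.
Let `q` be a polynomial of least degree with non-torsion `V`-value. Coefficients of `q`-expansions
have smaller degree, hence torsion values, so distinct nonzero terms have distinct `V`-values and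
the dominant one gives the value of the sum (`exists_dominant_term`). Coarsening from `V` to `ν`
keeps weak inequalities, which yields ν = ν_q (`exists_eq_truncation`). Both kinds of transcendence
are thus treated at once. Conversely, let ν = ν_q. If ν(q) is torsion modulo νK, some `a * q ^ n`
has value 0. Polynomials in it have `q`-expansions with constant coefficients, so ν = ν_q prevents
cancellation and its residue is transcendental (`isResidueTranscendental_of_truncation`). -/

namespace ValTrunc

/-! ### Values that are torsion modulo K -/

section TorsionValues

variable {K F Γ₀ : Type*} [Field K] [Field F] [Algebra K F] [LinearOrderedCommGroupWithZero Γ₀]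

/-- Some positive power of `x` has the same value as a constant from `K`. -/
def HasTorsionValue (K : Type*) {F Γ₀ : Type*} [Field K] [Field F] [Algebra K F]
    [LinearOrderedCommGroupWithZero Γ₀] (v : Valuation F Γ₀) (x : F) : Prop :=
  ∃ n : ℕ, 0 < n ∧ ∃ a : K, v x ^ n = v (algebraMap K F a)

theorem HasTorsionValue.algebraMap (v : Valuation F Γ₀) (a : K) :
    HasTorsionValue K v (algebraMap K F a) :=
  ⟨1, one_pos, a, pow_one _⟩

theorem HasTorsionValue.mul {v : Valuation F Γ₀} {x y : F} (hx : HasTorsionValue K v x)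
    (hy : HasTorsionValue K v y) : HasTorsionValue K v (x * y) := by
  obtain ⟨n, hn, a, ha⟩ := hx
  obtain ⟨m, hm, b, hb⟩ := hy
  refine ⟨n * m, Nat.mul_pos hn hm, a ^ m * b ^ n, ?_⟩
  rw [map_mul, mul_pow, pow_mul, ha, mul_comm n m, pow_mul, hb]
  simp

theorem HasTorsionValue.inv {v : Valuation F Γ₀} {x : F} (hx : HasTorsionValue K v x) :
    HasTorsionValue K v x⁻¹ := by
  obtain ⟨n, hn, a, ha⟩ := hx
  exact ⟨n, hn, a⁻¹, by rw [map_inv₀, inv_pow, ha, map_inv₀, map_inv₀]⟩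

theorem HasTorsionValue.of_pow {v : Valuation F Γ₀} {x : F} {n : ℕ} (hn : 0 < n)
    (hx : HasTorsionValue K v (x ^ n)) : HasTorsionValue K v x := by
  obtain ⟨m, hm, a, ha⟩ := hx
  exact ⟨n * m, Nat.mul_pos hn hm, a, by rw [← ha, map_pow, pow_mul]⟩

theorem HasTorsionValue.congr {v : Valuation F Γ₀} {x y : F} (h : v x = v y)
    (hx : HasTorsionValue K v x) : HasTorsionValue K v y := by
  obtain ⟨n, hn, a, ha⟩ := hx
  exact ⟨n, hn, a, by rw [← h, ha]⟩

/-- Terms `a * y ^ i` and `b * y ^ j` with torsion coefficients and non-torsion `y` have distinct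
values. -/
theorem val_mul_pow_ne {v : Valuation F Γ₀} {a b y : F} (ha : HasTorsionValue K v a)
    (hb : HasTorsionValue K v b) (hb0 : b ≠ 0) (hy : ¬ HasTorsionValue K v y) {i j : ℕ}
    (hij : i < j) : v (a * y ^ i) ≠ v (b * y ^ j) := by
  intro h
  -- The value 0 counts as torsion, because the constant may be 0.
  have hy0 : v y ≠ 0 := fun h0 => hy ⟨1, one_pos, 0, by simp [h0]⟩
  have hvb : v b ≠ 0 := (Valuation.ne_zero_iff v).2 hb0
  -- Cancelling `y ^ i` gives `y ^ (j - i)` the torsion value of `a * b⁻¹`.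
  refine hy (HasTorsionValue.of_pow (Nat.sub_pos_of_lt hij) ((ha.mul hb.inv).congr ?_))
  obtain ⟨d, rfl⟩ := Nat.exists_eq_add_of_lt hij
  rw [map_mul, map_pow, map_mul, map_pow, show i + d + 1 = i + (d + 1) by ring, pow_add,
    mul_left_comm, mul_comm (v a)] at h
  have h' := mul_left_cancel₀ (pow_ne_zero i hy0) h
  rw [show i + d + 1 - i = d + 1 by omega, map_mul, map_inv₀, map_pow, h', mul_comm (v b),
    mul_assoc, mul_inv_cancel₀ hvb, mul_one]

end TorsionValues

/-! ### Dominant terms of expansions -/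

section Truncation

universe u v

variable {K : Type u} [Field K]

/-- If `v` takes a non-torsion value on `K(x)`, then for some nonconstant `q` the value of every
polynomial is the value of a dominant term of its `q`-expansion. -/
theorem exists_dominant_term {Γ₀ : Type*} [LinearOrderedCommGroupWithZero Γ₀]
    (v : Valuation (RatFunc K) Γ₀) {f : RatFunc K} (hf : ¬ HasTorsionValue K v f) :
    ∃ q : K[X], 0 < q.natDegree ∧ ∀ p : K[X], ∃ j ∈ Finset.range (p.natDegree + 1),
      v (algebraMap K[X] (RatFunc K) p) =
        v (algebraMap K[X] (RatFunc K) (expansionCoeff q p j * q ^ j)) ∧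
      ∀ i ∈ Finset.range (p.natDegree + 1),
        v (algebraMap K[X] (RatFunc K) (expansionCoeff q p i * q ^ i)) ≤
          v (algebraMap K[X] (RatFunc K) (expansionCoeff q p j * q ^ j)) := by
  classical
  let T : K[X] → Prop := fun p => HasTorsionValue K v (algebraMap K[X] (RatFunc K) p)
  -- A quotient of torsion polynomials is torsion, so `f` forces a non-torsion polynomial; `q` is
  -- one of least degree.
  have hex : ∃ n, ∃ p : K[X], ¬ T p ∧ p.natDegree = n := by
    by_contra! h
    have hT : ∀ p, T p := fun p => by_contra fun hp => h _ p hp rfl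
    apply hf
    rw [← RatFunc.num_div_denom f, div_eq_mul_inv]
    exact (hT _).mul (hT _).inv
  obtain ⟨q, hq, hqd⟩ := Nat.find_spec hex
  have hmin : ∀ p : K[X], p.natDegree < q.natDegree → T p := fun p hp =>
    by_contra fun hp' => Nat.find_min hex (hqd ▸ hp) ⟨p, hp', rfl⟩
  have hq0 : 0 < q.natDegree := by
    rw [Nat.pos_iff_ne_zero]
    intro h
    obtain ⟨a, rfl⟩ := natDegree_eq_zero.1 h
    exact hq (HasTorsionValue.algebraMap (F := RatFunc K) v a)
  refine ⟨q, hq0, fun p => ?_⟩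
  obtain ⟨j, hj, hmax⟩ := Finset.exists_max_image (Finset.range (p.natDegree + 1))
    (fun i => v (algebraMap K[X] (RatFunc K) (expansionCoeff q p i * q ^ i))) ⟨0, by simp⟩
  refine ⟨j, hj, ?_, hmax⟩
  have hcoeff : ∀ i, T (expansionCoeff q p i) := fun i => by
    refine hmin _ ?_
    by_cases h : expansionCoeff q p i = 0
    · rwa [h, natDegree_zero]
    · exact natDegree_lt_natDegree h (degree_expansionCoeff_lt hq0 p i)
  have hinj := RatFunc.algebraMap_injective K
  conv_lhs => rw [← sum_expansionCoeff hq0 p _ (Nat.lt_succ_self _), map_sum]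
  -- If the largest term has value 0, strict dominance may fail, but then every term, and so the
  -- sum, has value 0.
  by_cases h0 : v (algebraMap K[X] (RatFunc K) (expansionCoeff q p j * q ^ j)) = 0
  · rw [h0]
    refine le_antisymm (v.map_sum_le fun i hi => ?_) zero_le
    exact (hmax i hi).trans h0.le
  refine v.map_sum_eq_of_lt hj fun i hi => ?_
  rw [Finset.mem_sdiff, Finset.mem_singleton] at hi
  refine lt_of_le_of_ne (hmax i hi.1) fun he => ?_
  have hne : ∀ k, v (algebraMap K[X] (RatFunc K) (expansionCoeff q p k * q ^ k)) ≠ 0 →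
      algebraMap K[X] (RatFunc K) (expansionCoeff q p k) ≠ 0 := by
    intro k hk h
    exact hk (by rw [map_mul, h, zero_mul, map_zero])
  have hi0 := hne i (he ▸ h0)
  have hj0 := hne j h0
  simp only [map_mul (algebraMap K[X] (RatFunc K)), map_pow (algebraMap K[X] (RatFunc K))] at he
  rcases lt_or_gt_of_ne hi.2 with hlt | hlt
  · exact val_mul_pow_ne (hcoeff i) (hcoeff j) hj0 hq hlt he
  · exact val_mul_pow_ne (hcoeff j) (hcoeff i) hi0 hq hlt he.symm

/-! ### Composite valuation rings and refinement -/

/-- The composition of a valuation ring `A` with a valuation ring of its residue field. -/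
def compositeValuationSubring {F : Type*} [Field F] (A : ValuationSubring F)
    (B : ValuationSubring (IsLocalRing.ResidueField A)) : ValuationSubring F where
  toSubring := (B.toSubring.comap (IsLocalRing.residue A)).map A.toSubring.subtype
  mem_or_inv_mem' x := by
    have key : ∀ y (hy : y ∈ A), y⁻¹ ∉ A →
        y ∈ (B.toSubring.comap (IsLocalRing.residue A)).map A.toSubring.subtype := by
      intro y hy hy'
      refine ⟨⟨y, hy⟩, ?_, rfl⟩
      -- Non-units of `A` have residue 0, so they lie in the composite ring whatever `B` is.
      have h0 : IsLocalRing.residue A ⟨y, hy⟩ = 0 := by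
        rw [IsLocalRing.residue_eq_zero_iff, IsLocalRing.mem_maximalIdeal, mem_nonunits_iff]
        intro hu
        obtain ⟨z, hz⟩ := hu.exists_right_inv
        have hz' : y * z = 1 := congrArg Subtype.val hz
        exact hy' (inv_eq_of_mul_eq_one_right hz' ▸ z.2)
      change IsLocalRing.residue A ⟨y, hy⟩ ∈ B
      rw [h0]
      exact B.zero_mem
    by_cases hx : x ∈ A
    · by_cases hx' : x⁻¹ ∈ A
      · by_cases hx0 : x = 0
        · subst hx0
          exact Or.inl (Subring.zero_mem _)
        have hmul : (⟨x, hx⟩ : A) * ⟨x⁻¹, hx'⟩ = 1 := Subtype.ext (mul_inv_cancel₀ hx0)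
        have hres : IsLocalRing.residue A ⟨x⁻¹, hx'⟩ = (IsLocalRing.residue A ⟨x, hx⟩)⁻¹ := by
          refine (inv_eq_of_mul_eq_one_right ?_).symm
          rw [← map_mul, hmul, map_one]
        rcases B.mem_or_inv_mem (IsLocalRing.residue A ⟨x, hx⟩) with h | h
        · exact Or.inl ⟨⟨x, hx⟩, h, rfl⟩
        · exact Or.inr ⟨⟨x⁻¹, hx'⟩, show _ ∈ B from hres ▸ h, rfl⟩
      · exact Or.inl (key x hx hx')
    · have hx' := (A.mem_or_inv_mem x).resolve_left hx
      exact Or.inr (key x⁻¹ hx' (by rwa [inv_inv]))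

theorem mem_compositeValuationSubring {F : Type*} [Field F] {A : ValuationSubring F}
    {B : ValuationSubring (IsLocalRing.ResidueField A)} {x : F} :
    x ∈ compositeValuationSubring A B ↔ ∃ h : x ∈ A, IsLocalRing.residue A ⟨x, h⟩ ∈ B := by
  constructor
  · rintro ⟨y, hy, rfl⟩
    exact ⟨y.2, hy⟩
  · rintro ⟨h, hx⟩
    exact ⟨⟨x, h⟩, hx, rfl⟩

theorem compositeValuationSubring_le {F : Type*} [Field F] (A : ValuationSubring F)
    (B : ValuationSubring (IsLocalRing.ResidueField A)) : compositeValuationSubring A B ≤ A :=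
  fun _ hx => (mem_compositeValuationSubring.1 hx).1

/-- A transcendental element can be inverted out of some valuation ring containing the base. -/
theorem exists_valuationSubring_inv_notMem {k L : Type*} [Field k] [Field L] [Algebra k L] {t : L}
    (ht : Transcendental k t) :
    ∃ B : ValuationSubring L, (∀ a : k, algebraMap k L a ∈ B) ∧ t⁻¹ ∉ B := by
  -- An integrally closed subring is cut out by the valuation rings above it, so it suffices that
  -- `t⁻¹` is not integral over `k`.
  have hmem : t⁻¹ ∉ (integralClosure k L).toSubring := by
    intro h
    have h' : IsIntegral k t⁻¹ := h
    exact ht (by simpa using h'.isAlgebraic.inv)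
  have : IsIntegrallyClosedIn (integralClosure k L).toSubring L :=
    inferInstanceAs (IsIntegrallyClosedIn (integralClosure k L) L)
  obtain ⟨B, hB, htB⟩ := Subring.exists_le_valuationSubring_of_isIntegrallyClosedIn hmem
  exact ⟨B, fun a => hB ((integralClosure k L).algebraMap_mem a), htB⟩

variable {Γ : Type v} [AddCommGroup Γ] [LinearOrder Γ] [IsOrderedAddMonoid Γ]

/-- Comparisons for a finer valuation ring carry over to `w`. -/
theorem le_of_valuation_le {F : Type*} [Field F] {w : AddValuation F (WithTop Γ)}
    {V : ValuationSubring F} (hV : V ≤ valRing w) {x y : F} (h : V.valuation x ≤ V.valuation y) :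
    w y ≤ w x := by
  -- `x` is a multiple of `y` by an element of `V`, which `w` sees as nonnegative; the order flips
  -- from multiplicative to additive notation.
  obtain ⟨a, rfl⟩ := (V.valuation_le_iff x y).1 h
  rw [AddValuation.map_mul]
  exact le_add_of_nonneg_left ((mem_valRing w _).1 (hV a.2))

theorem exists_eq_truncation (ν : AddValuation K[X] (WithTop Γ)) (hν : ν.supp = ⊥)
    {V : ValuationSubring (RatFunc K)} (hV : V ≤ valRing (ratVal ν hν)) {f : RatFunc K}
    (hf : ¬ HasTorsionValue K V.valuation f) :
    ∃ q : K[X], 0 < q.natDegree ∧ ∀ p : K[X], ν p = truncation ν q p := by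
  obtain ⟨q, hq, h⟩ := exists_dominant_term V.valuation hf
  refine ⟨q, hq, fun p => ?_⟩
  obtain ⟨j, hj, heq, hmax⟩ := h p
  have hcoarse : ∀ a b : K[X], V.valuation (algebraMap K[X] (RatFunc K) a) ≤
      V.valuation (algebraMap K[X] (RatFunc K) b) → ν b ≤ ν a := fun a b hab => by
    simpa only [ratVal_algebraMap] using le_of_valuation_le hV hab
  apply le_antisymm
  · exact Finset.le_inf fun i hi => hcoarse _ _ ((hmax i hi).trans heq.ge)
  · exact (Finset.inf_le hj).trans (hcoarse _ _ heq.le)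

theorem IsValueTranscendental.exists_valuationSubring {ν : AddValuation K[X] (WithTop Γ)}
    {hν : ν.supp = ⊥} (h : IsValueTranscendental ν hν) :
    ∃ V ≤ valRing (ratVal ν hν), ∃ f : RatFunc K, ¬ HasTorsionValue K V.valuation f := by
  obtain ⟨f, γ, hf, hγ⟩ := h
  refine ⟨_, le_rfl, f, ?_⟩
  rintro ⟨n, hn, a, ha⟩
  refine hγ n hn ((mem_valueGroup_iff _ _).2 ⟨a, ?_⟩)
  rw [← ratVal_algebraMap_base ν hν, WithTop.coe_nsmul, ← hf, ← AddValuation.map_pow]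
  rw [← map_pow] at ha
  exact le_antisymm (le_of_valuation_le le_rfl ha.le) (le_of_valuation_le le_rfl ha.ge)

/-- A relation between `f ^ n` and a constant `a` forces ν(a) = 0. Then `a⁻¹` has its residue in Kν,
hence in `B`, so `f⁻¹` lies in the composite ring and the inverse of the residue of `f` in `B`,
against the choice of `B`. -/
theorem IsResidueTranscendental.exists_valuationSubring {ν : AddValuation K[X] (WithTop Γ)}
    {hν : ν.supp = ⊥} (h : IsResidueTranscendental ν hν) :
    ∃ V ≤ valRing (ratVal ν hν), ∃ f : RatFunc K, ¬ HasTorsionValue K V.valuation f := by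
  obtain ⟨f, hf⟩ := h
  obtain ⟨B, hkB, htB⟩ := exists_valuationSubring_inv_notMem hf
  refine ⟨compositeValuationSubring _ B, compositeValuationSubring_le _ B, f, ?_⟩
  rintro ⟨n, hn, a, ha⟩
  rw [← map_pow] at ha
  have hw : ratVal ν hν ((f : RatFunc K) ^ n) = ratVal ν hν (algebraMap K (RatFunc K) a) :=
    le_antisymm (le_of_valuation_le (compositeValuationSubring_le _ B) ha.ge)
      (le_of_valuation_le (compositeValuationSubring_le _ B) ha.le)
  have hf0 : IsLocalRing.residue (valRing (ratVal ν hν)) f ≠ 0 :=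
    fun h0 => hf (h0 ▸ isAlgebraic_zero)
  have hunit : IsUnit f := by
    by_contra hu
    exact hf0 ((IsLocalRing.residue_eq_zero_iff f).2 hu)
  obtain ⟨g, hg⟩ := hunit.exists_right_inv
  have hg' : (f : RatFunc K) * g = 1 := congrArg Subtype.val hg
  have hwf : ratVal ν hν f = 0 := by
    have h1 := (mem_valRing _ _).1 f.2
    have h2 := (mem_valRing _ _).1 g.2
    have h3 : ratVal ν hν f + ratVal ν hν g = 0 := by
      rw [← AddValuation.map_mul, hg', AddValuation.map_one]
    exact le_antisymm (h3 ▸ le_add_of_nonneg_right h2) h1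
  have hwa : baseVal ν a = 0 := by
    rw [← ratVal_algebraMap_base ν hν, ← hw, AddValuation.map_pow, hwf, nsmul_zero]
  have haV : (algebraMap K (RatFunc K) a)⁻¹ ∈ compositeValuationSubring _ B := by
    rw [← map_inv₀]
    have hb : a⁻¹ ∈ valRing (baseVal ν) := by
      rw [mem_valRing, AddValuation.map_inv, hwa]
      simp
    have hb' : algebraMap K (RatFunc K) a⁻¹ ∈ valRing (ratVal ν hν) := by
      rw [mem_valRing, ratVal_algebraMap_base]
      exact hb
    refine mem_compositeValuationSubring.2 ⟨hb', ?_⟩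
    rw [← algebraMap_residue ν hν ⟨a⁻¹, hb⟩ hb']
    exact hkB _
  have hfn : ((f : RatFunc K) ^ n)⁻¹ ∈ compositeValuationSubring _ B := by
    rw [← ValuationSubring.valuation_le_one_iff, map_inv₀] at haV ⊢
    rwa [ha]
  have hfV : (f : RatFunc K)⁻¹ ∈ compositeValuationSubring _ B := by
    rw [← ValuationSubring.valuation_le_one_iff] at hfn ⊢
    rw [← inv_pow, map_pow] at hfn
    -- Valuation rings are closed under roots, so the exponent `n` can be dropped.
    exact (pow_le_one_iff hn.ne').1 hfn
  obtain ⟨h1, h2⟩ := mem_compositeValuationSubring.1 hfV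
  apply htB
  have hgi : (⟨(f : RatFunc K)⁻¹, h1⟩ : valRing (ratVal ν hν)) = g :=
    Subtype.ext (inv_eq_of_mul_eq_one_right hg')
  rw [hgi] at h2
  rwa [inv_eq_of_mul_eq_one_right (show IsLocalRing.residue (valRing (ratVal ν hν)) f *
    IsLocalRing.residue (valRing (ratVal ν hν)) g = 1 by rw [← map_mul, hg, map_one])]

/-! ### From ν = ν_q to transcendence -/

theorem mem_maximalIdeal_valRing_iff {F : Type*} [Field F] {w : AddValuation F (WithTop Γ)}
    {x : valRing w} : x ∈ IsLocalRing.maximalIdeal (valRing w) ↔ 0 < w x :=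
  (AddValuation.toValuation w).mem_maximalIdeal_iff

/-- If `ν = ν_q`, then an element `a * q ^ n` of value zero has transcendental residue. -/
theorem isResidueTranscendental_of_truncation {ν : AddValuation K[X] (WithTop Γ)}
    {hν : ν.supp = ⊥} {q : K[X]} (hq : 0 < q.natDegree)
    (h : ∀ p : K[X], ν p = truncation ν q p) {n : ℕ} (hn : 0 < n) {a : K}
    (ha : ν (C a * q ^ n) = 0) : IsResidueTranscendental ν hν := by
  have hf : algebraMap K[X] (RatFunc K) (C a * q ^ n) ∈ valRing (ratVal ν hν) := by
    rw [mem_valRing, ratVal_algebraMap, ha]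
  refine ⟨⟨_, hf⟩, ?_⟩
  rintro ⟨P, hP0, hP⟩
  choose c hc using fun i => IsLocalRing.residue_surjective (R := valRing (baseVal ν)) (P.coeff i)
  let e : ℕ → K := fun i => c i * a ^ i
  -- `p` lifts the relation `P`; its expansion has the constant `c i * a ^ i` at index `n * i` and 0
  -- at indices not divisible by `n`.
  let d : ℕ → K[X] := fun m =>
    C (∑ i ∈ Finset.range (P.natDegree + 1), if m = n * i then e i else 0)
  let p : K[X] := ∑ i ∈ Finset.range (P.natDegree + 1), C (c i : K) * (C a * q ^ n) ^ i
  have hp : ∑ m ∈ Finset.range (n * (P.natDegree + 1)), d m * q ^ m = p := by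
    simp only [d, p, map_sum, Finset.sum_mul]
    rw [Finset.sum_comm]
    refine Finset.sum_congr rfl fun i hi => ?_
    rw [Finset.sum_eq_single_of_mem (n * i)
      (Finset.mem_range.2 (Nat.mul_lt_mul_of_pos_left (Finset.mem_range.1 hi) hn))
      fun m _ hm => by rw [if_neg hm, map_zero, zero_mul]]
    rw [if_pos rfl, mul_pow, ← pow_mul, ← C_pow, ← mul_assoc, ← C_mul]
  have hj : P.natDegree ∈ Finset.range (P.natDegree + 1) := Finset.self_mem_range_succ _
  have hdj : d (n * P.natDegree) * q ^ (n * P.natDegree) =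
      C (c P.natDegree : K) * (C a * q ^ n) ^ P.natDegree := by
    simp only [d]
    rw [Finset.sum_eq_single_of_mem _ hj fun i _ hi => if_neg fun h =>
      hi (Nat.eq_of_mul_eq_mul_left hn h).symm]
    rw [if_pos rfl, mul_pow, ← pow_mul, ← C_pow, ← mul_assoc, ← C_mul]
  -- The leading coefficient of `P` is a nonzero residue, so its lift has no positive value; this
  -- one term bounds ν_q(p) by 0.
  have hcj : ν (C (c P.natDegree : K)) ≤ 0 := by
    by_contra! hlt
    refine hP0 (leadingCoeff_eq_zero.1 ?_)
    rw [leadingCoeff, ← hc, IsLocalRing.residue_eq_zero_iff]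
    exact mem_maximalIdeal_valRing_iff.2 hlt
  have hle : ν p ≤ 0 := by
    rw [h, truncation_eq ν hq _ d (fun m => degree_C_le.trans_lt (natDegree_pos_iff_degree_pos.1 hq))
      p hp]
    refine (Finset.inf_le (Finset.mem_range.2 (Nat.mul_lt_mul_of_pos_left
      (Nat.lt_succ_self P.natDegree) hn))).trans ?_
    rw [hdj, AddValuation.map_mul, AddValuation.map_pow, ha, nsmul_zero, add_zero]
    exact hcj
  let E : valRing (ratVal ν hν) := ∑ i ∈ Finset.range (P.natDegree + 1),
    algebraMap (valRing (baseVal ν)) (valRing (ratVal ν hν)) (c i) * ⟨_, hf⟩ ^ i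
  have hE : (E : RatFunc K) = algebraMap K[X] (RatFunc K) p := by
    simp only [E, p, map_sum, map_mul (algebraMap K[X] (RatFunc K)),
      map_pow (algebraMap K[X] (RatFunc K)), AddSubmonoidClass.coe_finsetSum]
    refine Finset.sum_congr rfl fun i _ => ?_
    rfl
  have hres : IsLocalRing.residue _ E = 0 := by
    rw [← hP, aeval_eq_sum_range, map_sum]
    refine Finset.sum_congr rfl fun i _ => ?_
    rw [map_mul, map_pow, Algebra.smul_def, ← hc]
    rfl
  -- The relation makes the residue of `p` vanish, so ν(p) > 0, contradicting the bound.
  have hpos := mem_maximalIdeal_valRing_iff.1 ((IsLocalRing.residue_eq_zero_iff E).1 hres)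
  rw [hE, ratVal_algebraMap] at hpos
  exact hle.not_gt hpos

theorem isValuationTranscendental_of_truncation {ν : AddValuation K[X] (WithTop Γ)}
    {hν : ν.supp = ⊥} {q : K[X]} (hq : 0 < q.natDegree)
    (h : ∀ p : K[X], ν p = truncation ν q p) : IsValuationTranscendental ν hν := by
  rw [isValuationTranscendental_iff]
  have hq0 : q ≠ 0 := by
    rintro rfl
    simp at hq
  have hνq : ν q ≠ ⊤ := fun ht => hq0 (by
    have : q ∈ ν.supp := ht
    rwa [hν, Ideal.mem_bot] at this)
  obtain ⟨γ, hγ⟩ := WithTop.ne_top_iff_exists.1 hνq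
  by_cases ht : ∀ n : ℕ, 0 < n → n • γ ∉ valueGroup (baseVal ν)
  · exact Or.inl ⟨algebraMap K[X] (RatFunc K) q, γ, by rw [ratVal_algebraMap, hγ], ht⟩
  push Not at ht
  obtain ⟨n, hn, hmem⟩ := ht
  -- The constant `a` has value `-(n • γ)`, which brings `C a * q ^ n` to value 0.
  obtain ⟨a, ha⟩ := (mem_valueGroup_iff _ _).1 ((valueGroup (baseVal ν)).neg_mem hmem)
  refine Or.inr (isResidueTranscendental_of_truncation hq h hn (a := a) ?_)
  rw [AddValuation.map_mul, AddValuation.map_pow, ← hγ, show ν (C a) = baseVal ν a from rfl, ha,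
    ← WithTop.coe_nsmul, ← WithTop.coe_add, neg_add_cancel, WithTop.coe_zero]

end Truncation

end ValTrunc

theorem theorem1p3 {K : Type*} [Field K] {Γ : Type*} [AddCommGroup Γ] [LinearOrder Γ]
    [IsOrderedAddMonoid Γ] (ν : AddValuation (Polynomial K) (WithTop Γ)) (hν : ν.supp = ⊥) :
    ValTrunc.IsValuationTranscendental ν hν ↔
      ∃ q : Polynomial K, 0 < q.natDegree ∧
        ∀ p : Polynomial K, ν p = ValTrunc.truncation ν q p := by
  constructor
  · intro h
    obtain ⟨V, hV, f, hf⟩ : ∃ V ≤ ValTrunc.valRing (ValTrunc.ratVal ν hν),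
        ∃ f : RatFunc K, ¬ ValTrunc.HasTorsionValue K V.valuation f :=
      ((ValTrunc.isValuationTranscendental_iff ν hν).1 h).elim
        ValTrunc.IsValueTranscendental.exists_valuationSubring
        ValTrunc.IsResidueTranscendental.exists_valuationSubring
    exact ValTrunc.exists_eq_truncation ν hν hV hf
  · rintro ⟨q, hq, h⟩
    exact ValTrunc.isValuationTranscendental_of_truncation hq h
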